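/- For $n\in\mathbb{N}$ let $\mathrm{QAP}_n\subset\mathbb{R}^{n^2\times n^2}$ be the QAP polytope, that is, the convex hull of the matrices $yy^{\mathsf T}$, where $y=\mathrm{vec}(P_\sigma)$ is the vectorization of the $n\times n$ permutation matrix $P_\sigma$ and $\sigma$ ranges over $S_n$. The entries of $Y\in\mathbb{R}^{n^2\times n^2}$ are written $Y_{ij,kl}$ with $i,j,k,l\in[n]$. For $n\ge 6$, the QAP1 inequalities are $$\sum_{r=1}^{m}Y_{i_rj_r,kl}-Y_{kl,kl}-\sum_{1\le r<s\le m}Y_{i_rj_r,i_sj_s}\le 0$$ for all $m\ge 3$, all distinct $i_1,\dots,i_m,k\in[n]$ and all distinct $j_1,\dots,j_m,l\in[n]$. A bounded relaxation of $\mathrm{QAP}_n$ is a polytope $R\subset\mathbb{R}^{n^2\times n^2}$ (a bounded solution set of finitely many linear inequalities) with $\mathrm{QAP}_n\subseteq R$. The extension complexity $\mathrm{xc}(P)$ of a polytope $P\subset\mathbb{R}^d$ is the minimum number of facets of a polytope $Q\subset\mathbb{R}^{d+r}$, over all $r\ge 0$, such that $P=\{x\in\mathbb{R}^d : \exists y\in\mathbb{R}^r,\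 (x,y)\in Q\}$. **Theorem.** There are a constant $c>0$ and $N\in\mathbb{N}$ such that for every $n\ge N$ and every bounded relaxation $R$ of $\mathrm{QAP}_n$ all of whose points satisfy all QAP1 inequalities, $$\mathrm{xc}(R)\ge 2^{cn}.$$ In short, $\mathrm{xc}(R)\ge 2^{\Omega(n)}$. -/

import Mathlib

namespace QAP

open scoped Matrix

/-- A polytope in `ℝ^ι`: a bounded set that is the solution set of a finite system of linear
inequalities `A x ≤ b`. -/
def IsPolytope {ι : Type*} [Fintype ι] (P : Set (ι → ℝ)) : Prop :=
  (∃ (m : ℕ) (A : Matrix (Fin m) ι ℝ) (b : Fin m → ℝ), P = {x | A *ᵥ x ≤ b}) ∧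
    Bornology.IsBounded P

open Classical in
/-- The (affine) dimension of a set of points, with the usual convention `dim ∅ = -1`. -/
noncomputable def dim {ι : Type*} [Fintype ι] (S : Set (ι → ℝ)) : ℤ :=
  if S = ∅ then -1 else (Module.finrank ℝ (vectorSpan ℝ S) : ℤ)

/-- `F` is a facet of the polytope `P`: a face of `P` of dimension `dim P - 1`. A face is the empty
set or the set of maximizers over `P` of a linear functional; this is Mathlib's `IsExposed`. -/
def IsFacet {ι : Type*} [Fintype ι] (P F : Set (ι → ℝ)) : Prop :=
  IsExposed ℝ P F ∧ dim F = dim P - 1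

/-- The size of a polytope: the number of its facets. -/
noncomputable def size {ι : Type*} [Fintype ι] (P : Set (ι → ℝ)) : ℕ :=
  {F : Set (ι → ℝ) | IsFacet P F}.ncard

/-- The polytope `Q ⊆ ℝ^ι × ℝ^r` is an extended formulation of `P ⊆ ℝ^ι`: the projection of `Q` to
the first group of coordinates is `P`. -/
def IsExtension {ι : Type*} [Fintype ι] {r : ℕ} (Q : Set (ι ⊕ Fin r → ℝ))
    (P : Set (ι → ℝ)) : Prop :=
  IsPolytope Q ∧ P = {x | ∃ y : Fin r → ℝ, Sum.elim x y ∈ Q}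

/-- The extension complexity of a polytope `P`: the smallest size of an extended formulation. -/
noncomputable def xc {ι : Type*} [Fintype ι] (P : Set (ι → ℝ)) : ℕ :=
  sInf {k : ℕ | ∃ (r : ℕ) (Q : Set (ι ⊕ Fin r → ℝ)), IsExtension Q P ∧ size Q = k}

/-- Every polytope has an extended formulation, so the minimum in `xc` is over a nonempty set. -/
theorem exists_isExtension {ι : Type*} [Fintype ι] {P : Set (ι → ℝ)} (hP : IsPolytope P) :
    ∃ (r : ℕ) (Q : Set (ι ⊕ Fin r → ℝ)), IsExtension Q P := by
  obtain ⟨⟨m, A, b, hA⟩, hb⟩ := hP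
  refine ⟨0, {z | (fun i => z (Sum.inl i)) ∈ P},
    ⟨⟨m, fun k => Sum.elim (A k) 0, b, ?_⟩, ?_⟩, ?_⟩
  · ext z
    simp [hA, Pi.le_def, Matrix.mulVec, dotProduct]
  · obtain ⟨C, hC⟩ := hb.exists_norm_le
    refine isBounded_iff_forall_norm_le.2 ⟨C, fun z hz => ?_⟩
    have h := hC _ hz
    refine (pi_norm_le_iff_of_nonneg ((norm_nonneg _).trans h)).2 fun i => ?_
    rcases i with i | i
    · exact (norm_le_pi_norm (fun i => z (Sum.inl i)) i).trans h
    · exact i.elim0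
  · ext x
    simp

/-- The index set of the entries of an `n² × n²` matrix `Y`; the entry `Y_{ij,kl}` is
`Y ((i, j), (k, l))`. -/
abbrev Idx (n : ℕ) : Type := (Fin n × Fin n) × (Fin n × Fin n)

/-- The matrix `y yᵀ`, where `y` is the vectorization of the permutation matrix of `σ`. -/
def vertex {n : ℕ} (σ : Equiv.Perm (Fin n)) : Idx n → ℝ :=
  fun p => σ.permMatrix ℝ p.1.1 p.1.2 * σ.permMatrix ℝ p.2.1 p.2.2

/-- The QAP polytope. -/
def polytope (n : ℕ) : Set (Idx n → ℝ) :=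
  convexHull ℝ (Set.range (vertex (n := n)))

/-- The point `Y` satisfies all QAP1 inequalities: for `n ≥ 6`, `m ≥ 3`, distinct
`i₁, …, i_m, k` and distinct `j₁, …, j_m, l`,
`∑_r Y_{i_r j_r, kl} - Y_{kl, kl} - ∑_{r < s} Y_{i_r j_r, i_s j_s} ≤ 0`. -/
def SatisfiesQAP1 {n : ℕ} (Y : Idx n → ℝ) : Prop :=
  6 ≤ n → ∀ m : ℕ, 3 ≤ m → ∀ (i j : Fin m → Fin n) (k l : Fin n),
    Function.Injective i → (∀ r, i r ≠ k) → Function.Injective j → (∀ r, j r ≠ l) →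
      ∑ r, Y ((i r, j r), (k, l)) - Y ((k, l), (k, l))
        - ∑ r, ∑ s ∈ Finset.Ioi r, Y ((i r, j r), (i s, j s)) ≤ 0

/-- `R` is a bounded relaxation of the QAP polytope. -/
def IsBoundedRelaxation {n : ℕ} (R : Set (Idx n → ℝ)) : Prop :=
  IsPolytope R ∧ polytope n ⊆ R

end QAP

/-! The bound comes from unique disjointness, through facets of an arbitrary extension `Q` of `R`.
Choose permutations indexed by sets `A` of blocks (fix the blocks in `A`, swap the two elements of
every other block) and QAP1 inequalities indexed by sets `B` of blocks. At the vertex of `A`, the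
inequality of `B` is strict when `A` and `B` are disjoint and tight when they meet in exactly one
block.

Lift the vertices to `Q` and pull the inequalities back. If `A` and `B` are disjoint, the face of
`Q` cut out by `B` misses the lift of `A`, so some facet contains the face and misses the lift
(`QAP.IsPolytope.exists_isFacet`). Each facet thus gives a rectangle of pairs `(A, B)`, and no pair
in it meets in exactly one block. Such a rectangle holds at most `2 ^ N` of the `3 ^ N` disjoint
pairs, so `Q` has at least `(3 / 2) ^ N` facets. -/

open Filter Topology

/-! ### Irredundant descriptions of polyhedra. -/

section Polyhedra

variable {E κ : Type*} [NormedAddCommGroup E] [NormedSpace ℝ E]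

/-- Moving a little in a direction that does not increase the tight constraints stays feasible. -/
theorem exists_pos_forall_add_smul_le (I : Finset κ) (l : κ → E →L[ℝ] ℝ) (b : κ → ℝ) (u d : E)
    (hu : ∀ i ∈ I, l i u ≤ b i) (hd : ∀ i ∈ I, l i u = b i → l i d ≤ 0) :
    ∃ ε : ℝ, 0 < ε ∧ ∀ i ∈ I, l i (u + ε • d) ≤ b i := by
  have key : ∀ᶠ ε : ℝ in 𝓝[>] 0, ∀ i ∈ I, l i (u + ε • d) ≤ b i := by
    rw [Filter.eventually_all_finset]
    intro i hi
    rcases (hu i hi).eq_or_lt with h | h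
    · filter_upwards [self_mem_nhdsWithin] with ε hε
      have := mul_nonpos_of_nonneg_of_nonpos (le_of_lt hε) (hd i hi h)
      simp only [map_add, map_smul, smul_eq_mul]
      linarith
    · have hc : ContinuousAt (fun ε : ℝ => l i (u + ε • d)) 0 := by fun_prop
      have h0 : ∀ᶠ ε : ℝ in 𝓝 0, l i (u + ε • d) < b i :=
        hc.eventually_lt continuousAt_const (by simpa using h)
      filter_upwards [nhdsWithin_le_nhds h0] with ε hε using hε.le
  obtain ⟨ε, h1, h2⟩ := (key.and self_mem_nhdsWithin).exists
  exact ⟨ε, h2, h1⟩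

/-- Averaging points that are strict for single constraints makes all of them strict at once; this
replaces a relative interior point. -/
theorem Convex.exists_forall_lt {S : Set E} (hS : Convex ℝ S) (hne : S.Nonempty)
    (l : κ → E →L[ℝ] ℝ) (b : κ → ℝ) (I : Finset κ)
    (hle : ∀ i ∈ I, ∀ x ∈ S, l i x ≤ b i) (hlt : ∀ i ∈ I, ∃ x ∈ S, l i x < b i) :
    ∃ p ∈ S, ∀ i ∈ I, l i p < b i := by
  classical
  induction I using Finset.induction_on with
  | empty => exact ⟨hne.some, hne.some_mem, by simp⟩
  | insert a I _ ih =>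
    obtain ⟨p, hp, hpI⟩ := ih (fun i hi => hle i (Finset.mem_insert_of_mem hi))
      fun i hi => hlt i (Finset.mem_insert_of_mem hi)
    obtain ⟨x, hx, hxa⟩ := hlt a (Finset.mem_insert_self a I)
    refine ⟨(1 / 2 : ℝ) • p + (1 / 2 : ℝ) • x,
      hS hp hx (by norm_num) (by norm_num) (by norm_num), fun i hi => ?_⟩
    have h1 := hle i hi x hx
    have h2 := hle i hi p hp
    simp only [map_add, map_smul, smul_eq_mul]
    rcases Finset.mem_insert.1 hi with rfl | hi
    · linarith
    · linarith [hpI i hi]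

/-- `I` describes the polyhedron `Q` within its affine hull. -/
def DescribesPolyhedron (l : κ → E →L[ℝ] ℝ) (b : κ → ℝ) (Q : Set E) (I : Finset κ) : Prop :=
  Q = {z | z ∈ affineSpan ℝ Q ∧ ∀ i ∈ I, l i z ≤ b i}

variable {l : κ → E →L[ℝ] ℝ} {b : κ → ℝ} {Q : Set E} {I : Finset κ}

namespace DescribesPolyhedron

theorem mem (h : DescribesPolyhedron l b Q I) {z : E} (hz : z ∈ affineSpan ℝ Q)
    (hI : ∀ i ∈ I, l i z ≤ b i) : z ∈ Q := by
  rw [h]; exact ⟨hz, hI⟩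

theorem le (h : DescribesPolyhedron l b Q I) {z : E} (hz : z ∈ Q) {i : κ} (hi : i ∈ I) :
    l i z ≤ b i := by
  rw [h] at hz; exact hz.2 i hi

theorem convex (h : DescribesPolyhedron l b Q I) : Convex ℝ Q := by
  intro x hx y hy s t hs ht hst
  refine h.mem ?_ fun i hi => ?_
  · have := (affineSpan ℝ Q).convex (subset_affineSpan ℝ Q hx) (subset_affineSpan ℝ Q hy) hs ht hst
    exact this
  · have h1 := mul_le_mul_of_nonneg_left (h.le hx hi) hs
    have h2 := mul_le_mul_of_nonneg_left (h.le hy hi) ht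
    simp only [map_add, map_smul, smul_eq_mul]
    calc _ ≤ s * b i + t * b i := add_le_add h1 h2
      _ = b i := by rw [← add_mul, hst, one_mul]

/-- A point outside an exposed face is outside one of the tight constraints of that face. -/
theorem exists_tight (h : DescribesPolyhedron l b Q I) (c : E →L[ℝ] ℝ) (δ : ℝ)
    (hc : ∀ z ∈ Q, c z ≤ δ) (hne : ∃ z ∈ Q, c z = δ) {q : E} (hq : q ∈ Q) (hqc : c q < δ) :
    ∃ i ∈ I, (∀ z ∈ Q, c z = δ → l i z = b i) ∧ l i q < b i := by
  classical
  -- Take `g` in the face where only constraints tight on the whole face are tight. If `q` were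
  -- tight for those too, one could move from `g` a little away from `q` inside `Q`, and `c` would
  -- exceed `δ`.
  by_contra! hcon
  have hG : Convex ℝ {z | z ∈ Q ∧ c z = δ} := by
    have := h.convex.inter (convex_hyperplane (c : E →ₗ[ℝ] ℝ).isLinear δ)
    exact this
  obtain ⟨g, ⟨hgQ, hgc⟩, hg⟩ := hG.exists_forall_lt (hne.imp fun _ h => h) l b
    (I.filter fun i => ¬ ∀ z ∈ Q, c z = δ → l i z = b i)
    (fun i hi x hx => h.le hx.1 (Finset.mem_filter.1 hi).1) (by
      intro i hi
      obtain ⟨hi, hz⟩ := Finset.mem_filter.1 hi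
      push Not at hz
      obtain ⟨z, hz, hzc, hzi⟩ := hz
      exact ⟨z, ⟨hz, hzc⟩, lt_of_le_of_ne (h.le hz hi) hzi⟩)
  obtain ⟨ε, hε, hεI⟩ := exists_pos_forall_add_smul_le I l b g (g - q)
    (fun i hi => h.le hgQ hi) (by
      intro i hi hgi
      by_cases ht : ∀ z ∈ Q, c z = δ → l i z = b i
      · have := hcon i hi ht
        simp only [map_sub]
        linarith
      · exact absurd hgi (hg i (Finset.mem_filter.2 ⟨hi, ht⟩)).ne)
  have hmem : g + ε • (g - q) ∈ Q := by
    refine h.mem ?_ hεI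
    have := AffineSubspace.vadd_mem_of_mem_direction
      ((affineSpan ℝ Q).direction.smul_mem ε
        (AffineSubspace.vsub_mem_direction (subset_affineSpan ℝ Q hgQ)
          (subset_affineSpan ℝ Q hq))) (subset_affineSpan ℝ Q hgQ)
    rwa [vadd_eq_add, vsub_eq_sub, add_comm] at this
  have h1 := hc _ hmem
  simp only [map_add, map_smul, map_sub, smul_eq_mul, hgc] at h1
  nlinarith [mul_pos hε (sub_pos.2 hqc)]

end DescribesPolyhedron

theorem exists_minimal_describesPolyhedron [Finite κ] (l : κ → E →L[ℝ] ℝ) (b : κ → ℝ) :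
    ∃ I : Finset κ, Minimal (DescribesPolyhedron l b {z | ∀ i, l i z ≤ b i}) I := by
  classical
  have := Fintype.ofFinite κ
  refine exists_minimal_of_wellFoundedLT _ ⟨Finset.univ, ?_⟩
  ext z
  simp only [Finset.mem_univ, Set.mem_ofPred_eq, forall_const]
  exact ⟨fun h => ⟨subset_affineSpan ℝ _ h, h⟩, fun h => h.2⟩

/-- In an irredundant description, every constraint is tight on a set of codimension one. -/
theorem finrank_vectorSpan_tight [FiniteDimensional ℝ E]
    (h : Minimal (DescribesPolyhedron l b Q) I) (hQ : Q.Nonempty) {i : κ} (hi : i ∈ I) :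
    {z | z ∈ Q ∧ l i z = b i}.Nonempty ∧
    Module.finrank ℝ (vectorSpan ℝ {z | z ∈ Q ∧ l i z = b i}) + 1 =
      Module.finrank ℝ (vectorSpan ℝ Q) := by
  classical
  have hd := h.prop
  -- a point violating only the constraint `i`
  have hw : ∃ w ∈ affineSpan ℝ Q, (∀ j ∈ I, j ≠ i → l j w ≤ b j) ∧ b i < l i w := by
    by_contra! hcon
    have : DescribesPolyhedron l b Q (I.erase i) := by
      apply Set.Subset.antisymm
      · exact fun z hz => ⟨subset_affineSpan ℝ Q hz,
          fun j hj => hd.le hz (Finset.mem_of_mem_erase hj)⟩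
      · rintro z ⟨hz, hzI⟩
        refine hd.mem hz fun j hj => ?_
        by_cases hji : j = i
        · rw [hji]
          exact hcon z hz fun j hj hji => hzI j (Finset.mem_erase.2 ⟨hji, hj⟩)
        · exact hzI j (Finset.mem_erase.2 ⟨hji, hj⟩)
    exact Finset.notMem_erase i I (h.le_of_le this (Finset.erase_subset i I) hi)
  obtain ⟨w, hwQ, hwI, hwi⟩ := hw
  -- A constraint tight on all of `Q` is already implied by the affine span, so minimality excludes
  -- it.
  have hstrict : ∀ j ∈ I, ∃ x ∈ Q, l j x < b j := by
    intro j hj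
    by_contra! hcon
    have heq : ∀ z ∈ affineSpan ℝ Q, l j z = b j := by
      intro z hz
      have hsub : affineSpan ℝ Q ≤
          (affineSpan ℝ {b j}).comap (l j : E →ₗ[ℝ] ℝ).toAffineMap := by
        rw [affineSpan_le]
        intro x hx
        simpa using le_antisymm (hd.le hx hj) (hcon x hx)
      simpa using hsub hz
    have : DescribesPolyhedron l b Q (I.erase j) := by
      apply Set.Subset.antisymm
      · exact fun z hz => ⟨subset_affineSpan ℝ Q hz,
          fun j hj => hd.le hz (Finset.mem_of_mem_erase hj)⟩
      · rintro z ⟨hz, hzI⟩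
        refine hd.mem hz fun k hk => ?_
        by_cases hkj : k = j
        · rw [hkj]; exact (heq z hz).le
        · exact hzI k (Finset.mem_erase.2 ⟨hkj, hk⟩)
    exact Finset.notMem_erase j I (h.le_of_le this (Finset.erase_subset j I) hj)
  obtain ⟨p, hpQ, hp⟩ := hd.convex.exists_forall_lt hQ l b I
    (fun j hj x hx => hd.le hx hj) hstrict
  have hpA := subset_affineSpan ℝ Q hpQ
  -- the point of the segment from `p` to `w` at which the constraint `i` is tight
  obtain ⟨t, ht0, ht1, hti⟩ : ∃ t : ℝ, 0 < t ∧ t < 1 ∧ (1 - t) * l i p + t * l i w = b i := by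
    have hpi := hp i hi
    have hpos : 0 < l i w - l i p := by linarith
    refine ⟨(b i - l i p) / (l i w - l i p), div_pos (by linarith) hpos,
      (div_lt_one hpos).2 (by linarith), ?_⟩
    field_simp
    ring
  set u : E := (1 - t) • p + t • w with hu
  have huA : u ∈ affineSpan ℝ Q :=
    (affineSpan ℝ Q).convex hpA hwQ (by linarith) ht0.le (by ring)
  have hui : l i u = b i := by
    simp only [hu, map_add, map_smul, smul_eq_mul, hti]
  have huj : ∀ j ∈ I, j ≠ i → l j u < b j := by
    intro j hj hji
    have h1 := mul_lt_mul_of_pos_left (hp j hj) (sub_pos.2 ht1)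
    have h2 := mul_le_mul_of_nonneg_left (hwI j hj hji) ht0.le
    simp only [hu, map_add, map_smul, smul_eq_mul]
    linarith
  have huI : ∀ j ∈ I, l j u ≤ b j := by
    intro j hj
    by_cases hji : j = i
    · rw [hji, hui]
    · exact (huj j hj hji).le
  have huQ : u ∈ Q := hd.mem huA huI
  refine ⟨⟨u, huQ, hui⟩, ?_⟩
  -- Only the constraint `i` is tight at `u`, so small moves from `u` within its hyperplane stay in
  -- `Q`.
  have hspan : vectorSpan ℝ {z | z ∈ Q ∧ l i z = b i} =
      vectorSpan ℝ Q ⊓ LinearMap.ker (l i : E →ₗ[ℝ] ℝ) := by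
    apply le_antisymm
    · refine le_inf (vectorSpan_mono ℝ fun z hz => hz.1) ?_
      rw [vectorSpan_def, Submodule.span_le]
      rintro _ ⟨x, hx, y, hy, rfl⟩
      simp [hx.2, hy.2]
    · rintro v ⟨hvQ, hv⟩
      have hv0 : l i v = 0 := hv
      obtain ⟨ε, hε, hεI⟩ := exists_pos_forall_add_smul_le I l b u v huI (by
        intro j hj hjt
        by_cases hji : j = i
        · rw [hji, hv0]
        · exact absurd hjt (huj j hj hji).ne)
      have hmem : u + ε • v ∈ Q := by
        refine hd.mem ?_ hεI
        have := AffineSubspace.vadd_mem_of_mem_direction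
          ((affineSpan ℝ Q).direction.smul_mem ε
            (by rwa [direction_affineSpan])) huA
        rwa [vadd_eq_add, add_comm] at this
      have := vsub_mem_vectorSpan ℝ (s := {z | z ∈ Q ∧ l i z = b i})
        (p₁ := u + ε • v) (p₂ := u) ⟨hmem, by simp [hui, hv0]⟩ ⟨huQ, hui⟩
      rw [vsub_eq_sub, add_sub_cancel_left] at this
      exact (Submodule.smul_mem_iff _ hε.ne').1 this
  set V := vectorSpan ℝ Q
  have hne : (l i : E →ₗ[ℝ] ℝ).domRestrict V ≠ 0 := by
    intro h0
    have hup : u - p ∈ V := vsub_mem_vectorSpan ℝ huQ hpQ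
    have := LinearMap.congr_fun h0 ⟨u - p, hup⟩
    have hpi := hp i hi
    simp [hui] at this
    linarith
  have hker : LinearMap.ker ((l i : E →ₗ[ℝ] ℝ).domRestrict V) =
      (LinearMap.ker (l i : E →ₗ[ℝ] ℝ)).comap V.subtype := by
    ext; simp
  rw [hspan, ← Module.Dual.finrank_ker_add_one_of_ne_zero hne, hker,
    ← Submodule.map_comap_subtype, Submodule.finrank_map_subtype_eq]

end Polyhedra

/-! ### Facets of polytopes. -/

namespace QAP

variable {ι : Type*} [Fintype ι] {Q : Set (ι → ℝ)}

theorem IsPolytope.exists_functionals (hQ : IsPolytope Q) :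
    ∃ (m : ℕ) (l : Fin m → (ι → ℝ) →L[ℝ] ℝ) (b : Fin m → ℝ), Q = {z | ∀ i, l i z ≤ b i} := by
  obtain ⟨⟨m, A, b, rfl⟩, -⟩ := hQ
  refine ⟨m, fun i => LinearMap.toContinuousLinearMap
    ((LinearMap.proj i).comp (Matrix.mulVecLin A)), b, ?_⟩
  ext z
  simp [Pi.le_def]

/-- A polytope is cut out by facets: each nonempty exposed face that misses a point `q` lies in a
facet that misses `q`. -/
theorem IsPolytope.exists_isFacet (hQ : IsPolytope Q) (c : (ι → ℝ) →L[ℝ] ℝ) (δ : ℝ)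
    (hc : ∀ z ∈ Q, c z ≤ δ) (hne : ∃ z ∈ Q, c z = δ) {q : ι → ℝ} (hq : q ∈ Q) (hqc : c q < δ) :
    ∃ F, IsFacet Q F ∧ (∀ z ∈ Q, c z = δ → z ∈ F) ∧ q ∉ F := by
  obtain ⟨m, l, b, rfl⟩ := hQ.exists_functionals
  obtain ⟨I, hI⟩ := exists_minimal_describesPolyhedron l b
  obtain ⟨i, hi, hti, hqi⟩ := hI.prop.exists_tight c δ hc hne hq hqc
  obtain ⟨⟨u, hu, hui⟩, hdim⟩ := finrank_vectorSpan_tight hI ⟨q, hq⟩ hi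
  refine ⟨{z | z ∈ {z | ∀ i, l i z ≤ b i} ∧ l i z = b i}, ⟨fun _ => ⟨l i, ?_⟩, ?_⟩,
    fun z hz hzc => ⟨hz, hti z hz hzc⟩, fun h => hqi.ne h.2⟩
  · ext z
    refine and_congr_right fun hz => ⟨fun h y hy => h ▸ hy i, fun h => ?_⟩
    exact le_antisymm (hz i) (hui ▸ h u hu)
  · have h1 : {z | z ∈ {z | ∀ i, l i z ≤ b i} ∧ l i z = b i} ≠ ∅ :=
      Set.Nonempty.ne_empty ⟨u, hu, hui⟩
    have h2 : {z | ∀ i, l i z ≤ b i} ≠ ∅ := Set.Nonempty.ne_empty ⟨q, hq⟩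
    rw [dim, dim, if_neg h1, if_neg h2, ← hdim]
    push_cast
    ring

/-- A nonempty exposed face is determined by the constraints tight on it. Finiteness matters because
`ncard` of an infinite set is `0`. -/
theorem IsPolytope.finite_setOf_isFacet (hQ : IsPolytope Q) : {F | IsFacet Q F}.Finite := by
  classical
  obtain ⟨m, l, b, hl⟩ := hQ.exists_functionals
  obtain ⟨I, hI⟩ := exists_minimal_describesPolyhedron l b
  rw [← hl] at hI
  refine ((Set.finite_range
    fun J : Finset (Fin m) => {z | z ∈ Q ∧ ∀ i ∈ J, l i z = b i}).insert ∅).subset ?_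
  rintro F ⟨hF, -⟩
  rcases F.eq_empty_or_nonempty with rfl | ⟨g, hg⟩
  · exact Set.mem_insert _ _
  refine Set.mem_insert_of_mem _ ⟨I.filter fun i => ∀ z ∈ F, l i z = b i, ?_⟩
  obtain ⟨c, hc⟩ := hF ⟨g, hg⟩
  have hgQ := hc ▸ hg
  ext z
  constructor
  · rintro ⟨hz, hzI⟩
    by_contra hzF
    have hlt : c z < c g := by
      refine lt_of_not_ge fun h => hzF ?_
      rw [hc]
      exact ⟨hz, fun y hy => (hgQ.2 y hy).trans h⟩
    obtain ⟨i, hi, hti, hlt⟩ := hI.prop.exists_tight c (c g) hgQ.2 ⟨g, hgQ.1, rfl⟩ hz hlt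
    refine hlt.ne (hzI i (Finset.mem_filter.2 ⟨hi, fun y hy => ?_⟩))
    rw [hc] at hy
    exact hti y hy.1 (le_antisymm (hgQ.2 y hy.1) (hy.2 g hgQ.1))
  · intro hz
    exact ⟨hF.subset hz, fun i hi => (Finset.mem_filter.1 hi).2 z hz⟩

end QAP

/-! ### Rectangle covers of the disjoint pairs. -/

section Disjointness

variable {α : Type*} [DecidableEq α]

/-- Each element lies in `A`, in `B`, or in neither. -/
theorem Finset.sum_powerset_disjoint (s : Finset α) :
    ∑ A ∈ s.powerset, ∑ B ∈ s.powerset, (if Disjoint A B then 1 else 0) = 3 ^ s.card := by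
  induction s using Finset.induction_on with
  | empty => simp
  | insert a s ha ih =>
    rw [Finset.card_insert_of_notMem ha, pow_succ, ← ih]
    simp only [Finset.sum_powerset_insert ha]
    rw [mul_comm, Finset.mul_sum, ← Finset.sum_add_distrib]
    refine Finset.sum_congr rfl fun A hA => ?_
    rw [Finset.mul_sum, ← Finset.sum_add_distrib, ← Finset.sum_add_distrib,
      ← Finset.sum_add_distrib]
    refine Finset.sum_congr rfl fun B hB => ?_
    have hA : a ∉ A := fun h => ha (Finset.mem_powerset.1 hA h)
    have hB : a ∉ B := fun h => ha (Finset.mem_powerset.1 hB h)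
    simp [hA, hB]
    split_ifs <;> rfl

open Classical in
/-- A rectangle without pairs that meet in exactly one element contains at most `2 ^ n` disjoint
pairs of subsets of an `n`-element set. -/
theorem Finset.sum_powerset_rectangle_le (s : Finset α) (P R : Finset α → Prop)
    (h : ∀ A ⊆ s, ∀ B ⊆ s, P A → R B → (A ∩ B).card ≠ 1) :
    ∑ A ∈ s.powerset, ∑ B ∈ s.powerset, (if P A ∧ R B ∧ Disjoint A B then 1 else 0)
      ≤ 2 ^ s.card := by
  induction s using Finset.induction_on generalizing P R with
  | empty =>
    simp only [Finset.powerset_empty, Finset.sum_singleton, Finset.card_empty, pow_zero]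
    split_ifs <;> simp
  | insert a s ha ih =>
    have hs : s ⊆ insert a s := Finset.subset_insert a s
    have hins : ∀ {A}, A ⊆ s → insert a A ⊆ insert a s := Finset.insert_subset_insert a
    -- A disjoint pair in `s` has three disjoint extensions by `a`. Since `insert a A` and `insert a
    -- B` cannot both be selected, those of the three in the rectangle are counted by two projected
    -- rectangles: one forgets `a` on the left, the other on the right.
    have ih₁ := ih (fun A => P A ∨ P (insert a A)) R (by
      rintro A hA B hB (hPA | hPA) hRB
      · exact h A (hA.trans hs) B (hB.trans hs) hPA hRB
      · have := h _ (hins hA) B (hB.trans hs) hPA hRB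
        rwa [Finset.insert_inter_of_notMem fun h => ha (hB h)] at this)
    have ih₂ := ih P (fun B => R B ∨ R (insert a B)) (by
      rintro A hA B hB hPA (hRB | hRB)
      · exact h A (hA.trans hs) B (hB.trans hs) hPA hRB
      · have := h A (hA.trans hs) _ (hins hB) hPA hRB
        rwa [Finset.inter_insert_of_notMem fun h => ha (hA h)] at this)
    rw [Finset.card_insert_of_notMem ha, pow_succ, mul_two]
    refine le_trans ?_ (add_le_add ih₁ ih₂)
    simp only [Finset.sum_powerset_insert ha]
    rw [← Finset.sum_add_distrib, ← Finset.sum_add_distrib]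
    refine Finset.sum_le_sum fun A hA => ?_
    rw [← Finset.sum_add_distrib, ← Finset.sum_add_distrib, ← Finset.sum_add_distrib,
      ← Finset.sum_add_distrib]
    refine Finset.sum_le_sum fun B hB => ?_
    rw [Finset.mem_powerset] at hA hB
    have hA' : a ∉ A := fun h => ha (hA h)
    have hB' : a ∉ B := fun h => ha (hB h)
    have hnot : Disjoint A B → P (insert a A) → R (insert a B) → False := by
      intro hd hP hR
      refine h _ (hins hA) _ (hins hB) hP hR ?_
      rw [← Finset.insert_inter_distrib, Finset.disjoint_iff_inter_eq_empty.1 hd]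
      simp
    by_cases hd : Disjoint A B
    · have := hnot hd
      simp only [Finset.disjoint_insert_left, Finset.disjoint_insert_right, hA', hB', hd,
        Finset.mem_insert_self, not_true, not_false_eq_true, and_true, and_false]
      generalize P A = p, P (insert a A) = p', R B = r, R (insert a B) = r' at this
      clear * - this
      by_cases p <;> by_cases p' <;> by_cases r <;> by_cases r' <;> simp_all
    · simp [hd]

open Classical in
/-- The rectangle covering bound for unique disjointness. -/
theorem three_pow_le_card_mul_two_pow {β : Type*} (s : Finset α) (T : Finset β)
    (P R : β → Finset α → Prop)
    (hcover : ∀ A ⊆ s, ∀ B ⊆ s, Disjoint A B → ∃ F ∈ T, P F A ∧ R F B)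
    (h : ∀ F ∈ T, ∀ A ⊆ s, ∀ B ⊆ s, P F A → R F B → (A ∩ B).card ≠ 1) :
    3 ^ s.card ≤ T.card * 2 ^ s.card := by
  calc 3 ^ s.card = ∑ A ∈ s.powerset, ∑ B ∈ s.powerset, (if Disjoint A B then 1 else 0) :=
        (Finset.sum_powerset_disjoint s).symm
    _ ≤ ∑ A ∈ s.powerset, ∑ B ∈ s.powerset, ∑ F ∈ T,
          (if P F A ∧ R F B ∧ Disjoint A B then 1 else 0) := by
        refine Finset.sum_le_sum fun A hA => Finset.sum_le_sum fun B hB => ?_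
        split_ifs with hd
        · obtain ⟨F, hF, hP, hR⟩ :=
            hcover A (Finset.mem_powerset.1 hA) B (Finset.mem_powerset.1 hB) hd
          refine le_trans ?_ (Finset.single_le_sum (fun _ _ => Nat.zero_le _) hF)
          simp [hP, hR, hd]
        · exact Nat.zero_le _
    _ = ∑ F ∈ T, ∑ A ∈ s.powerset, ∑ B ∈ s.powerset,
          (if P F A ∧ R F B ∧ Disjoint A B then 1 else 0) := by
        rw [Finset.sum_comm (s := T)]
        exact Finset.sum_congr rfl fun A _ => Finset.sum_comm
    _ ≤ T.card • 2 ^ s.card := Finset.sum_le_card_nsmul T _ _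
        fun F hF => Finset.sum_powerset_rectangle_le s (P F) (R F) (h F hF)
    _ = T.card * 2 ^ s.card := smul_eq_mul _ _

end Disjointness

/-! ### Block permutations and the slacks of QAP1 inequalities. -/

namespace QAP

/-- The linear form `∑ r, Y ((i_r, i_r), (k, k)) - Y ((k, k), (k, k)) -
∑ r < s, Y ((i_r, i_r), (i_s, i_s))` of the QAP1 inequalities with `j = i` and `l = k`. -/
def diagForm {n m : ℕ} (i : Fin m → Fin n) (k : Fin n) : (Idx n → ℝ) →ₗ[ℝ] ℝ :=
  ∑ r, LinearMap.proj ((i r, i r), (k, k)) - LinearMap.proj ((k, k), (k, k))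
    - ∑ r, ∑ s ∈ Finset.Ioi r, LinearMap.proj ((i r, i r), (i s, i s))

theorem diagForm_apply {n m : ℕ} (i : Fin m → Fin n) (k : Fin n) (Y : Idx n → ℝ) :
    diagForm i k Y = ∑ r, Y ((i r, i r), (k, k)) - Y ((k, k), (k, k))
      - ∑ r, ∑ s ∈ Finset.Ioi r, Y ((i r, i r), (i s, i s)) := by
  simp [diagForm, LinearMap.sum_apply]

theorem vertex_diag {n : ℕ} (σ : Equiv.Perm (Fin n)) (x y : Fin n) :
    vertex σ ((x, x), (y, y)) = if σ x = x ∧ σ y = y then 1 else 0 := by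
  simp only [vertex, Equiv.Perm.permMatrix, PEquiv.toMatrix_apply, Equiv.toPEquiv_apply,
    Option.mem_some_iff, ite_and, mul_ite, mul_one, mul_zero]
  split_ifs <;> rfl

/-- If `σ` fixes `k` and exactly `f` of the `i r`, with `i` injective, the form equals `f - 1 - f (f
- 1) / 2 = -(f - 1) (f - 2) / 2`. Only `f = 0` and `f = 1` are needed. -/
theorem diagForm_vertex_of_forall_ne {n m : ℕ} (i : Fin m → Fin n) (k : Fin n)
    (σ : Equiv.Perm (Fin n)) (hk : σ k = k) (h : ∀ r, σ (i r) ≠ i r) :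
    diagForm i k (vertex σ) = -1 := by
  simp [diagForm_apply, vertex_diag, hk, h]

theorem diagForm_vertex_of_fixed_iff {n m : ℕ} (i : Fin m → Fin n) (k : Fin n)
    (σ : Equiv.Perm (Fin n)) (hk : σ k = k) (r₀ : Fin m) (h : ∀ r, σ (i r) = i r ↔ r = r₀) :
    diagForm i k (vertex σ) = 0 := by
  have : ∑ r, ∑ s ∈ Finset.Ioi r, vertex σ ((i r, i r), (i s, i s)) = 0 := by
    refine Finset.sum_eq_zero fun r _ => Finset.sum_eq_zero fun s hs => ?_
    rw [vertex_diag, if_neg]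
    rw [h, h]
    rintro ⟨rfl, rfl⟩
    exact lt_irrefl _ (Finset.mem_Ioi.1 hs)
  rw [diagForm_apply, this]
  simp [vertex_diag, hk, h]

/-- The map on `ℕ` that swaps `2 t` and `2 t + 1` for all `t < M` outside of `C`. -/
def blockSwap (M : ℕ) (C : Finset ℕ) (x : ℕ) : ℕ :=
  if x / 2 ∈ C ∨ M ≤ x / 2 then x else if x % 2 = 0 then x + 1 else x - 1

theorem blockSwap_div_two (M : ℕ) (C : Finset ℕ) (x : ℕ) : blockSwap M C x / 2 = x / 2 := by
  unfold blockSwap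
  split_ifs <;> omega

theorem blockSwap_blockSwap (M : ℕ) (C : Finset ℕ) (x : ℕ) :
    blockSwap M C (blockSwap M C x) = x := by
  have h := blockSwap_div_two M C x
  rw [blockSwap, h]
  unfold blockSwap
  split_ifs <;> omega

theorem blockSwap_lt {n M : ℕ} (hM : 2 * M ≤ n) (C : Finset ℕ) {x : ℕ} (hx : x < n) :
    blockSwap M C x < n := by
  unfold blockSwap
  split_ifs <;> omega

/-- `blockSwap` as a permutation of `Fin n`. -/
def blockPerm {n M : ℕ} (hM : 2 * M ≤ n) (C : Finset ℕ) : Equiv.Perm (Fin n) :=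
  Function.Involutive.toPerm (fun x => ⟨blockSwap M C x, blockSwap_lt hM C x.2⟩)
    fun x => Fin.ext (blockSwap_blockSwap M C x)

theorem blockPerm_eq_self_iff {n M : ℕ} (hM : 2 * M ≤ n) (C : Finset ℕ) (x : Fin n) :
    blockPerm hM C x = x ↔ (x : ℕ) / 2 ∈ C ∨ M ≤ (x : ℕ) / 2 := by
  rw [Fin.ext_iff]
  change blockSwap M C x = x ↔ _
  unfold blockSwap
  split_ifs with h1 h2 <;> simp only [h1, iff_false] <;> omega

/-- The even elements `2 t` of the blocks `t ∈ B`. -/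
def blockPoint {n M : ℕ} (hM : 2 * M ≤ n) {B : Finset ℕ} (hB : B ⊆ Finset.range M)
    (r : Fin B.card) : Fin n :=
  ⟨2 * B.orderEmbOfFin rfl r, by
    have := Finset.mem_range.1 (hB (B.orderEmbOfFin_mem rfl r))
    omega⟩

theorem blockPoint_injective {n M : ℕ} (hM : 2 * M ≤ n) {B : Finset ℕ}
    (hB : B ⊆ Finset.range M) : Function.Injective (blockPoint hM hB) := by
  intro r s h
  rw [blockPoint, blockPoint, Fin.mk.injEq] at h
  exact (B.orderEmbOfFin rfl).injective (by omega)

theorem blockPerm_blockPoint {n M : ℕ} (hM : 2 * M ≤ n) {B : Finset ℕ}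
    (hB : B ⊆ Finset.range M) (C : Finset ℕ) (r : Fin B.card) :
    blockPerm hM C (blockPoint hM hB r) = blockPoint hM hB r ↔ B.orderEmbOfFin rfl r ∈ C := by
  have := Finset.mem_range.1 (hB (B.orderEmbOfFin_mem rfl r))
  have h2 : ((blockPoint hM hB r : Fin n) : ℕ) / 2 = B.orderEmbOfFin rfl r := by
    simp [blockPoint]
  rw [blockPerm_eq_self_iff, h2, or_iff_left (by omega)]

section

variable {n M : ℕ} (hM : 2 * M < n) {B : Finset ℕ} (hB : B ⊆ Finset.range M) (C : Finset ℕ)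

theorem diagForm_blockPerm_of_disjoint (h : Disjoint C B) :
    diagForm (blockPoint hM.le hB) ⟨2 * M, hM⟩ (vertex (blockPerm hM.le C)) = -1 := by
  refine diagForm_vertex_of_forall_ne _ _ _ ?_ fun r hr => ?_
  · rw [blockPerm_eq_self_iff]; simp
  · rw [blockPerm_blockPoint] at hr
    exact Finset.disjoint_left.1 h hr (B.orderEmbOfFin_mem rfl r)

theorem diagForm_blockPerm_of_card_eq_one (h : (C ∩ B).card = 1) :
    diagForm (blockPoint hM.le hB) ⟨2 * M, hM⟩ (vertex (blockPerm hM.le C)) = 0 := by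
  obtain ⟨t, ht⟩ := Finset.card_eq_one.1 h
  have htB : t ∈ B := Finset.mem_of_mem_inter_right (ht ▸ Finset.mem_singleton_self t)
  obtain ⟨r₀, rfl⟩ : t ∈ Set.range (B.orderEmbOfFin rfl) := by
    rw [Finset.range_orderEmbOfFin]; exact htB
  refine diagForm_vertex_of_fixed_iff _ _ _ ?_ r₀ fun r => ?_
  · rw [blockPerm_eq_self_iff]; simp
  · rw [blockPerm_blockPoint, ← (B.orderEmbOfFin rfl).injective.eq_iff, ← Finset.mem_singleton,
      ← ht, Finset.mem_inter, and_iff_left (B.orderEmbOfFin_mem rfl r)]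

theorem SatisfiesQAP1.diagForm_nonpos {Y : Idx n → ℝ} (hY : SatisfiesQAP1 Y) (hn : 6 ≤ n)
    (hB3 : 3 ≤ B.card) : diagForm (blockPoint hM.le hB) ⟨2 * M, hM⟩ Y ≤ 0 := by
  have hne : ∀ r, blockPoint hM.le hB r ≠ ⟨2 * M, hM⟩ := by
    intro r h
    rw [blockPoint, Fin.mk.injEq] at h
    have := Finset.mem_range.1 (hB (B.orderEmbOfFin_mem rfl r))
    omega
  rw [diagForm_apply]
  exact hY hn B.card hB3 _ _ _ _ (blockPoint_injective hM.le hB) hne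
    (blockPoint_injective hM.le hB) hne

end

/-! ### The lower bound on extensions. -/

theorem three_pow_le_size_mul_two_pow {n N r : ℕ} (hN : 2 * (N + 3) < n) {R : Set (Idx n → ℝ)}
    (hR : polytope n ⊆ R) (hQAP : ∀ Y ∈ R, SatisfiesQAP1 Y) {Q : Set (Idx n ⊕ Fin r → ℝ)}
    (hQ : IsExtension Q R) : 3 ^ N ≤ size Q * 2 ^ N := by
  classical
  obtain ⟨hQ, hproj⟩ := hQ
  have hlift : ∀ σ : Equiv.Perm (Fin n), ∃ y : Fin r → ℝ, Sum.elim (vertex σ) y ∈ Q := by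
    intro σ
    have : vertex σ ∈ R := hR (subset_convexHull ℝ _ ⟨σ, rfl⟩)
    rwa [hproj] at this
  choose y hy using hlift
  let q : Finset ℕ → Idx n ⊕ Fin r → ℝ := fun C =>
    Sum.elim (vertex (blockPerm hN.le C)) (y (blockPerm hN.le C))
  have hq : ∀ C, q C ∈ Q := fun C => hy _
  -- Three padding blocks give `B ∪ D` the at least three elements that QAP1 requires. No `A ⊆ range
  -- N` meets them, so intersections are unchanged.
  let D : Finset ℕ := {N, N + 1, N + 2}
  have hD : ∀ {B}, B ⊆ Finset.range N → B ∪ D ⊆ Finset.range (N + 3) := by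
    intro B hB x hx
    rcases Finset.mem_union.1 hx with hx | hx
    · exact Finset.range_mono (Nat.le_add_right N 3) (hB hx)
    · simp only [D, Finset.mem_insert, Finset.mem_singleton] at hx
      exact Finset.mem_range.2 (by omega)
  have hAD : ∀ {A}, A ⊆ Finset.range N → Disjoint A D := by
    intro A hA
    rw [Finset.disjoint_left]
    intro x hx
    have := hA hx
    simp only [D, Finset.mem_insert, Finset.mem_singleton, Finset.mem_range] at *
    omega
  -- the functional of the inequality for `B`, pulled back to the extended space
  let c : ∀ B, B ⊆ Finset.range N → (Idx n ⊕ Fin r → ℝ) →L[ℝ] ℝ := fun B hB =>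
    LinearMap.toContinuousLinearMap
      ((diagForm (blockPoint hN.le (hD hB)) ⟨2 * (N + 3), hN⟩).comp (LinearMap.funLeft ℝ ℝ Sum.inl))
  have hcq : ∀ B hB C, c B hB (q C) = diagForm (blockPoint hN.le (hD hB)) ⟨2 * (N + 3), hN⟩
      (vertex (blockPerm hN.le C)) := fun B hB C => rfl
  have hc : ∀ B hB, ∀ z ∈ Q, c B hB z ≤ 0 := by
    intro B hB z hz
    refine (hQAP (z ∘ Sum.inl) ?_).diagForm_nonpos hN (hD hB) (by omega) ?_
    · rw [hproj]
      exact ⟨z ∘ Sum.inr, by rwa [Sum.elim_comp_inl_inr]⟩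
    · calc 3 = D.card := by simp [D]
        _ ≤ _ := Finset.card_le_card Finset.subset_union_right
  have hfin := hQ.finite_setOf_isFacet
  have hcard := three_pow_le_card_mul_two_pow (Finset.range N) hfin.toFinset
    (fun F A => q A ∉ F) (fun F B => ∃ hB, ∀ z ∈ Q, c B hB z = 0 → z ∈ F) ?_ ?_
  · rwa [← Set.ncard_eq_toFinset_card _ hfin, Finset.card_range] at hcard
  · intro A hA B hB hAB
    obtain ⟨F, hF, hBF, hAF⟩ := hQ.exists_isFacet (c B hB) 0 (hc B hB)
      -- The face of `B` is nonempty: `{N}` meets `B ∪ D` only in the padding block `N`.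
      ⟨q {N}, hq _, by
        rw [hcq B hB]
        apply diagForm_blockPerm_of_card_eq_one
        rw [Finset.singleton_inter_of_mem (by simp [D]), Finset.card_singleton]⟩
      (hq A) (by
        rw [hcq B hB, diagForm_blockPerm_of_disjoint]
        · norm_num
        · exact Finset.disjoint_union_right.2 ⟨hAB, hAD hA⟩)
    exact ⟨F, hfin.mem_toFinset.2 hF, hAF, hB, hBF⟩
  · rintro F - A hA B - hAF ⟨hB, hBF⟩ hAB
    refine hAF (hBF _ (hq A) ?_)
    rw [hcq B hB]
    apply diagForm_blockPerm_of_card_eq_one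
    rwa [Finset.inter_union_distrib_left, Finset.disjoint_iff_inter_eq_empty.1 (hAD hA),
      Finset.union_empty]

theorem three_pow_le_xc_mul_two_pow {n N : ℕ} (hN : 2 * (N + 3) < n) {R : Set (Idx n → ℝ)}
    (hR : IsBoundedRelaxation R) (hQAP : ∀ Y ∈ R, SatisfiesQAP1 Y) :
    3 ^ N ≤ xc R * 2 ^ N := by
  -- Without an extension, `sInf ∅ = 0` would make the bound fail.
  obtain ⟨r, Q, hQ⟩ := exists_isExtension hR.1
  obtain ⟨r, Q, hQ, hsize⟩ := Nat.sInf_mem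
    (s := {k : ℕ | ∃ (r : ℕ) (Q : Set (Idx n ⊕ Fin r → ℝ)), IsExtension Q R ∧ size Q = k})
    ⟨_, r, Q, hQ, rfl⟩
  rw [xc, ← hsize]
  exact three_pow_le_size_mul_two_pow hN hR.2 hQAP hQ

end QAP

theorem mainTheorem2 :
    ∃ c : ℝ, 0 < c ∧ ∃ N : ℕ, ∀ n : ℕ, N ≤ n → ∀ R : Set (QAP.Idx n → ℝ),
      QAP.IsBoundedRelaxation R → (∀ Y ∈ R, QAP.SatisfiesQAP1 Y) →
        (2 : ℝ) ^ (c * (n : ℝ)) ≤ (QAP.xc R : ℝ) := by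
  refine ⟨1 / 8, by norm_num, 32, fun n hn R hR hQAP => ?_⟩
  -- With `N = 2 * k`, `(3 / 2) ^ N = (9 / 4) ^ k ≥ 2 ^ k`, and `n ≤ 8 * k` turns this into `2 ^ (n
  -- / 8)`.
  obtain ⟨k, hk1, hk2⟩ : ∃ k : ℕ, 2 * (2 * k + 3) < n ∧ n ≤ 8 * k :=
    ⟨(n - 7) / 4, by omega, by omega⟩
  have h := QAP.three_pow_le_xc_mul_two_pow hk1 hR hQAP
  have hpow : 2 ^ k * 2 ^ (2 * k) ≤ QAP.xc R * 2 ^ (2 * k) := by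
    refine le_trans ?_ h
    rw [pow_mul, pow_mul, ← mul_pow]
    exact Nat.pow_le_pow_left (by norm_num) k
  have hk : (2 : ℝ) ^ k ≤ QAP.xc R := by
    exact_mod_cast Nat.le_of_mul_le_mul_right hpow (by positivity)
  refine le_trans ?_ hk
  rw [← Real.rpow_natCast]
  refine Real.rpow_le_rpow_of_exponent_le (by norm_num) ?_
  have : (n : ℝ) ≤ 8 * k := by exact_mod_cast hk2
  linarith
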